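/- **Definitions.** Let $v_1,\dots,v_n$ be distinct points of the plane and let $a_1,\dots,a_n$ be simple arcs such that $a_i$ joins $v_i$ to $v_{i+1}$ (indices modulo $n$) and two different arcs meet exactly in the endpoints that they share. The closed region $P$ delimited by the simple closed curve $a_1\cup\dots\cup a_n$ is a *curvilinear polygon* with vertices $v_i$ and edges $a_i$. $P$ is *piecewise-convex* if * every edge is a convex arc, that is, every line of the plane meets it in at most two points or along a line segment, and * every point $p$ of the boundary other than a vertex is the centre of a disk $D_p$ of positive radius such that $P\cap D_p$ is convex. A *diagonal* of $P$ is a straight-line segment contained in $P$ that joins two different vertices of $P$. A *mobile guard* is an edge or a diagonal of $P$. A *mobile guard set* of $P$ is a set $G$ of mobile guards such that for every point $p$ in the interior of $P$ there is a point $q$ of some guard in $G$ for which the segment $\overline{pq}$ is contained in $P$. **Theorem.** For every integer $n\ge 3$ there is a piecewise-convex polygon with $n$ vertices every mobile guard set of which has at least $\lfloor n/3\rfloor$ elements. -/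

import Mathlib

/-- The Euclidean plane. -/
abbrev Plane : Type := EuclideanSpace ℝ (Fin 2)

/-- The vertices and arcs of a curvilinear polygon with `n` vertices. The `i`-th arc joins the
`i`-th vertex to the next one, indices being taken cyclically. Each arc is a simple arc; two
different arcs meet exactly in the end points that they share. (A simple arc has two different
end points, so there is no such object with `n = 1`.) -/
structure CurvilinearPolygon (n : ℕ) [NeZero n] where
  vertex : Fin n → Plane
  vertex_injective : Function.Injective vertex
  arc : (i : Fin n) → Path (vertex i) (vertex (i + 1))
  arc_injective : ∀ i, Function.Injective (arc i)
  arc_inter : ∀ i j, i ≠ j →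
    Set.range (arc i) ∩ Set.range (arc j) =
      {vertex i, vertex (i + 1)} ∩ {vertex j, vertex (j + 1)}

/-- A set `a` (the trace of an arc) is a convex arc if every line meets it in at most two points
or along a line segment. -/
def IsConvexArc (a : Set Plane) : Prop :=
  ∀ x y : Plane, x ≠ y →
    (a ∩ (affineSpan ℝ {x, y} : AffineSubspace ℝ Plane)).encard ≤ 2 ∨
      ∃ p q : Plane, a ∩ (affineSpan ℝ {x, y} : AffineSubspace ℝ Plane) = segment ℝ p q

namespace CurvilinearPolygon

variable {n : ℕ} [NeZero n] (P : CurvilinearPolygon n)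

/-- The `i`-th edge, as a set of points. -/
def edge (i : Fin n) : Set Plane := Set.range (P.arc i)

/-- The simple closed curve formed by all the edges. -/
def boundary : Set Plane := ⋃ i, P.edge i

/-- The closed region delimited by the edges: the points of the boundary, and the points whose
connected component in the complement of the boundary is bounded. (For a point of the boundary,
`connectedComponentIn` is the empty set, which is bounded.) -/
def region : Set Plane :=
  {p | Bornology.IsBounded (connectedComponentIn P.boundaryᶜ p)}

/-- Every boundary point that is not a vertex is the centre of a disk
in which the polygon is convex. -/
def IsLocallyConvex : Prop :=
  ∀ p ∈ P.boundary, p ∉ Set.range P.vertex →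
    ∃ r : ℝ, 0 < r ∧ Convex ℝ (P.region ∩ Metric.closedBall p r)

/-- A piecewise-convex polygon: locally convex, and all its edges are convex arcs. -/
def IsPiecewiseConvex : Prop :=
  P.IsLocallyConvex ∧ ∀ i, IsConvexArc (P.edge i)

/-- `p` is visible from `q`: the segment between them lies in the (closed) polygon. -/
def Visible (p q : Plane) : Prop := segment ℝ p q ⊆ P.region

/-- A diagonal: a line segment in the polygon that joins two different vertices. -/
def IsDiagonal (g : Set Plane) : Prop :=
  ∃ i j : Fin n, i ≠ j ∧ g = segment ℝ (P.vertex i) (P.vertex j) ∧ g ⊆ P.region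

/-- A mobile guard is an edge or a diagonal. -/
def IsMobileGuard (g : Set Plane) : Prop :=
  (∃ i, g = P.edge i) ∨ P.IsDiagonal g

/-- A set `G` of mobile guards such that every point in the interior of the polygon is visible
from some point of some guard in `G`. -/
def IsMobileGuardSet (G : Set (Set Plane)) : Prop :=
  (∀ g ∈ G, P.IsMobileGuard g) ∧
    ∀ p ∈ interior P.region, ∃ g ∈ G, ∃ q ∈ g, P.Visible p q

end CurvilinearPolygon

open Set Topology Filter

/-! Put k = ⌊n/3⌋. The example is a comb with k teeth at distance 4. Tooth j has the vertices A =
(4j, 0), B = (4j+3, 2), C = (4j+1, 1): one edge climbs the wall from A and follows the top to the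
tip B, the next returns below the tip to C, the third descends towards the next A. The base lies on
x + 6y = 0. A convex corner inside an edge violates neither convexity condition, so the corner (4j,
2) costs no vertex and three vertices per tooth suffice; the remaining n − 3k ≤ 2 vertices go on the
base.

A point near B sees only what the reflex vertex C leaves open, and this lies in 4j ≤ x ≤ 4j+3, y ≥
2/5 (`bounds_of_segment_subset_body`). Above height 2/5 each edge stays in one tooth
(`tooth_of_mem_side`), and a segment between two teeth crosses the gap between them
(`not_segment_subset_body`). So a mobile guard serves at most one tip, and k tips need k guards.

The region is computed as an explicit set `body`: three half-planes minus one convex gap per tooth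
(`region_polygon`). Local convexity can then fail only at corners of gaps, and those that lie in
`body` are vertices (`convexNear_body`). -/

/-! ### Segments in coordinates and injective paths -/

theorem Plane.ext {a b : Plane} (h0 : a 0 = b 0) (h1 : a 1 = b 1) : a = b := by
  ext i; fin_cases i <;> assumption

theorem Plane.mem_segment_iff {a b z : Plane} :
    z ∈ segment ℝ a b ↔ ∃ t : ℝ, 0 ≤ t ∧ t ≤ 1 ∧
      z 0 = a 0 + t * (b 0 - a 0) ∧ z 1 = a 1 + t * (b 1 - a 1) := by
  rw [segment_eq_image']
  constructor
  · rintro ⟨t, ⟨h0, h1⟩, rfl⟩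
    exact ⟨t, h0, h1, by simp, by simp⟩
  · rintro ⟨t, h0, h1, hx, hy⟩
    exact ⟨t, ⟨h0, h1⟩, Plane.ext (by simp [hx]) (by simp [hy])⟩

/-- A segment on a line that is not vertical, in coordinates. -/
theorem Plane.mem_segment_iff_of_lt {a b z : Plane} (m c : ℝ) (hab : a 0 < b 0)
    (ha : a 1 = m * a 0 + c) (hb : b 1 = m * b 0 + c) :
    z ∈ segment ℝ a b ↔ a 0 ≤ z 0 ∧ z 0 ≤ b 0 ∧ z 1 = m * z 0 + c := by
  rw [Plane.mem_segment_iff]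
  constructor
  · rintro ⟨t, h0, h1, hx, hy⟩
    refine ⟨by nlinarith, by nlinarith, ?_⟩
    rw [hy, hx, ha, hb]; ring
  · rintro ⟨h0, h1, h2⟩
    have hd : 0 < b 0 - a 0 := sub_pos.2 hab
    have hx : (z 0 - a 0) / (b 0 - a 0) * (b 0 - a 0) = z 0 - a 0 := div_mul_cancel₀ _ hd.ne'
    refine ⟨(z 0 - a 0) / (b 0 - a 0), div_nonneg (by linarith) hd.le,
      (div_le_one hd).2 (by linarith), by linarith, ?_⟩
    rw [h2, ha, hb]
    linear_combination -m * hx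

/-- A vertical segment, in coordinates. -/
theorem Plane.mem_segment_iff_of_vertical {a b z : Plane} (h : a 0 = b 0) (hab : a 1 < b 1) :
    z ∈ segment ℝ a b ↔ z 0 = a 0 ∧ a 1 ≤ z 1 ∧ z 1 ≤ b 1 := by
  rw [Plane.mem_segment_iff]
  constructor
  · rintro ⟨t, h0, h1, hx, hy⟩
    refine ⟨by rw [hx, h]; ring, by nlinarith, by nlinarith⟩
  · rintro ⟨h0, h1, h2⟩
    have hd : 0 < b 1 - a 1 := sub_pos.2 hab
    have hx : (z 1 - a 1) / (b 1 - a 1) * (b 1 - a 1) = z 1 - a 1 := div_mul_cancel₀ _ hd.ne'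
    refine ⟨(z 1 - a 1) / (b 1 - a 1), div_nonneg (by linarith) hd.le,
      (div_le_one hd).2 (by linarith), by rw [h0, ← h]; ring, by linarith⟩

theorem Plane.not_collinear_triple {a b c : Plane}
    (h : (b 0 - a 0) * (c 1 - a 1) ≠ (b 1 - a 1) * (c 0 - a 0)) :
    ¬ Collinear ℝ ({a, b, c} : Set Plane) := by
  intro hc
  rw [collinear_iff_exists_forall_eq_smul_vadd] at hc
  obtain ⟨p, v, hv⟩ := hc
  obtain ⟨r, rfl⟩ := hv a (by simp)
  obtain ⟨s, rfl⟩ := hv b (by simp)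
  obtain ⟨t, rfl⟩ := hv c (by simp)
  apply h
  simp
  ring

theorem Path.trans_injective {X : Type*} [TopologicalSpace X] {a b c : X}
    {γ : Path a b} {γ' : Path b c} (h : Function.Injective γ) (h' : Function.Injective γ')
    (hi : range γ ∩ range γ' ⊆ {b}) : Function.Injective (γ.trans γ') := by
  have key : ∀ (s t : unitInterval), (s : ℝ) ≤ 1 / 2 → ¬ (t : ℝ) ≤ 1 / 2 →
      γ.trans γ' s ≠ γ.trans γ' t := by
    intro s t hs ht heq
    rw [Path.trans_apply, Path.trans_apply, dif_pos hs, dif_neg ht] at heq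
    have hb := hi ⟨⟨_, rfl⟩, ⟨_, heq.symm⟩⟩
    rw [mem_singleton_iff, heq] at hb
    have := congrArg Subtype.val (h' (hb.trans γ'.source.symm))
    simp only [Set.Icc.coe_zero] at this
    push Not at ht
    linarith
  intro s t hst
  by_cases hs : (s : ℝ) ≤ 1 / 2 <;> by_cases ht : (t : ℝ) ≤ 1 / 2
  · rw [Path.trans_apply, Path.trans_apply, dif_pos hs, dif_pos ht] at hst
    have := congrArg Subtype.val (h hst)
    simp only at this
    exact Subtype.ext (by linarith)
  · exact (key s t hs ht hst).elim
  · exact (key t s ht hs hst.symm).elim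
  · rw [Path.trans_apply, Path.trans_apply, dif_neg hs, dif_neg ht] at hst
    have := congrArg Subtype.val (h' hst)
    simp only at this
    exact Subtype.ext (by linarith)

theorem Path.segment_injective {a b : Plane} (h : a ≠ b) :
    Function.Injective (Path.segment a b) := by
  intro s t hst
  exact Subtype.ext (AffineMap.lineMap_injective ℝ h hst)

/-! ### Convex arcs made of one or two segments -/

theorem segment_subset_affineSpan_of_mem {a b p q : Plane} {L : AffineSubspace ℝ Plane}
    (hpq : p ≠ q) (hp : p ∈ segment ℝ a b) (hq : q ∈ segment ℝ a b) (hpL : p ∈ L) (hqL : q ∈ L) :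
    a ∈ L ∧ b ∈ L := by
  have hs : segment ℝ a b ⊆ (affineSpan ℝ {a, b} : AffineSubspace ℝ Plane) := by
    rw [← convexHull_pair]
    exact convexHull_subset_affineSpan _
  have heq := affineSpan_pair_eq_of_mem_of_mem_of_ne (hs hp) (hs hq) hpq
  have hle : (affineSpan ℝ {a, b} : AffineSubspace ℝ Plane) ≤ L := by
    rw [← heq]
    exact affineSpan_pair_le_of_mem_of_mem hpL hqL
  exact ⟨hle (left_mem_affineSpan_pair ℝ a b), hle (right_mem_affineSpan_pair ℝ a b)⟩

theorem segment_subset_affineSubspace {a b : Plane} {L : AffineSubspace ℝ Plane}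
    (ha : a ∈ L) (hb : b ∈ L) : segment ℝ a b ⊆ L :=
  L.convex.segment_subset ha hb

theorem segment_inter_line (a b : Plane) (L : AffineSubspace ℝ Plane) :
    (segment ℝ a b ∩ L).Subsingleton ∨ (a ∈ L ∧ b ∈ L) := by
  by_cases h : (segment ℝ a b ∩ L).Subsingleton
  · exact .inl h
  · right
    rw [Set.not_subsingleton_iff] at h
    obtain ⟨p, hp, q, hq, hpq⟩ := h
    exact segment_subset_affineSpan_of_mem hpq hp.1 hq.1 hp.2 hq.2

theorem isConvexArc_segment (a b : Plane) : IsConvexArc (segment ℝ a b) := by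
  intro x y _
  rcases segment_inter_line a b (affineSpan ℝ {x, y}) with h | ⟨ha, hb⟩
  · left
    exact (encard_le_one_iff_subsingleton.2 h).trans (by norm_num)
  · right
    exact ⟨a, b, inter_eq_left.2 (segment_subset_affineSubspace ha hb)⟩

theorem segment_inter_segment_of_not_collinear {a m b : Plane}
    (h : ¬ Collinear ℝ ({a, m, b} : Set Plane)) :
    segment ℝ a m ∩ segment ℝ m b ⊆ {m} := by
  rintro z ⟨h1, h2⟩
  by_contra hz
  have hz : z ≠ m := hz
  have hzL := left_mem_affineSpan_pair ℝ z m
  have hmL := right_mem_affineSpan_pair ℝ z m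
  have ha := segment_subset_affineSpan_of_mem hz h1 (right_mem_segment ℝ a m) hzL hmL
  have hb := segment_subset_affineSpan_of_mem hz h2 (left_mem_segment ℝ m b) hzL hmL
  exact h (collinear_triple_of_mem_affineSpan_pair ha.1 hmL hb.2)

/-- A line meets each piece in at most one point or contains it. It cannot contain both, and if it
contains one it meets the other only in the joint `m`. -/
theorem isConvexArc_segment_union_segment {a m b : Plane}
    (h : ¬ Collinear ℝ ({a, m, b} : Set Plane)) :
    IsConvexArc (segment ℝ a m ∪ segment ℝ m b) := by
  intro x y _
  have hL : ∀ L : AffineSubspace ℝ Plane, L = affineSpan ℝ {x, y} →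
      ¬ (a ∈ L ∧ m ∈ L ∧ b ∈ L) := by
    rintro L rfl ⟨h1, h2, h3⟩
    exact h (collinear_triple_of_mem_affineSpan_pair h1 h2 h3)
  generalize hdef : affineSpan ℝ {x, y} = L
  replace hL := hL L hdef.symm
  rcases segment_inter_line a m L with h1 | ⟨ha, hm⟩ <;>
    rcases segment_inter_line m b L with h2 | ⟨hm', hb⟩
  · left
    rw [union_inter_distrib_right]
    refine (encard_union_le _ _).trans ?_
    refine (add_le_add (encard_le_one_iff_subsingleton.2 h1)
      (encard_le_one_iff_subsingleton.2 h2)).trans ?_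
    norm_num
  · right
    refine ⟨m, b, Subset.antisymm ?_ fun z hz =>
      ⟨.inr hz, segment_subset_affineSubspace hm' hb hz⟩⟩
    rintro z ⟨hz | hz, hzL⟩
    · rw [h1 ⟨hz, hzL⟩ ⟨right_mem_segment ℝ a m, hm'⟩]
      exact left_mem_segment ℝ m b
    · exact hz
  · right
    refine ⟨a, m, Subset.antisymm ?_ fun z hz =>
      ⟨.inl hz, segment_subset_affineSubspace ha hm hz⟩⟩
    rintro z ⟨hz | hz, hzL⟩
    · exact hz
    · rw [h2 ⟨hz, hzL⟩ ⟨left_mem_segment ℝ m b, hm⟩]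
      exact right_mem_segment ℝ a m
  · exact (hL ⟨ha, hm, hb⟩).elim

/-! ### Identifying the region of a polygon -/

/-- A criterion for a set to be the region delimited by the edges, which avoids the
Jordan curve theorem. -/
theorem CurvilinearPolygon.region_eq {n : ℕ} [NeZero n] (P : CurvilinearPolygon n)
    {K : Set Plane} (hB : P.boundary ⊆ K) (hK : Bornology.IsBounded K) (hcl : IsClosed K)
    (hint : ∀ z ∈ K, z ∉ P.boundary → K ∈ 𝓝 z)
    (hout : ∀ z ∉ K, ∃ S : Set Plane, z ∈ S ∧ IsPreconnected S ∧ S ⊆ Kᶜ ∧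
      ¬ Bornology.IsBounded S) : P.region = K := by
  have hbc : IsClosed P.boundary :=
    isClosed_iUnion_of_finite fun i => (isCompact_range (P.arc i).continuous).isClosed
  have hopen : IsOpen (K \ P.boundary) := by
    rw [isOpen_iff_mem_nhds]
    rintro z ⟨hz, hzb⟩
    exact inter_mem (hint z hz hzb) (hbc.isOpen_compl.mem_nhds hzb)
  ext z
  by_cases hzb : z ∈ P.boundary
  · refine iff_of_true ?_ (hB hzb)
    change Bornology.IsBounded (connectedComponentIn P.boundaryᶜ z)
    rw [connectedComponentIn_eq_empty (by simpa using hzb)]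
    exact Bornology.isBounded_empty
  by_cases hz : z ∈ K
  · refine iff_of_true ?_ hz
    refine hK.subset (Subset.trans ?_ (sdiff_subset (t := P.boundary)))
    have hsub := connectedComponentIn_subset P.boundaryᶜ z
    -- The component is covered by the disjoint open sets `K \ P.boundary` and `Kᶜ`, hence stays in
    -- the one that contains `z`.
    refine isPreconnected_connectedComponentIn.subset_left_of_subset_union hopen
      hcl.isOpen_compl ?_ ?_ ⟨z, mem_connectedComponentIn hzb, hz, hzb⟩
    · exact disjoint_left.2 fun w hw hw' => hw' hw.1
    · intro w hw
      by_cases hwK : w ∈ K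
      · exact .inl ⟨hwK, hsub hw⟩
      · exact .inr hwK
  · refine iff_of_false ?_ hz
    intro hb
    obtain ⟨S, hzS, hS, hSK, hSb⟩ := hout z hz
    have hb : Bornology.IsBounded (connectedComponentIn P.boundaryᶜ z) := hb
    exact hSb (hb.subset (hS.subset_connectedComponentIn hzS
      (hSK.trans (compl_subset_compl.2 hB))))

/-! ### Local convexity -/

/-- Convexity of a set near a point. -/
def ConvexNear (S : Set Plane) (p : Plane) : Prop :=
  ∀ᶠ r in 𝓝[>] (0 : ℝ), Convex ℝ (S ∩ Metric.closedBall p r)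

theorem ConvexNear.exists_pos {S : Set Plane} {p : Plane} (h : ConvexNear S p) :
    ∃ r : ℝ, 0 < r ∧ Convex ℝ (S ∩ Metric.closedBall p r) := by
  obtain ⟨r, h1, h2⟩ := (h.and self_mem_nhdsWithin).exists
  exact ⟨r, h2, h1⟩

theorem ConvexNear.of_eventuallyEq {S T : Set Plane} {p : Plane} (hT : Convex ℝ T)
    (h : ∀ᶠ z in 𝓝 p, z ∈ S ↔ z ∈ T) : ConvexNear S p := by
  obtain ⟨ε, hε, hb⟩ := Metric.nhds_basis_closedBall.eventually_iff.1 h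
  filter_upwards [Ioo_mem_nhdsGT hε] with r hr
  have : S ∩ Metric.closedBall p r = T ∩ Metric.closedBall p r := by
    ext z
    simp only [mem_inter_iff, and_congr_left_iff]
    exact fun hz => hb (Metric.closedBall_subset_closedBall hr.2.le hz)
  rw [this]
  exact hT.inter (convex_closedBall p r)

/-- Quantifying over all small radii lets finitely many sets share one radius. -/
theorem ConvexNear.inter {S T : Set Plane} {p : Plane} (hS : ConvexNear S p)
    (hT : ConvexNear T p) : ConvexNear (S ∩ T) p := by
  filter_upwards [hS, hT] with r h1 h2
  rw [inter_inter_distrib_right]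
  exact h1.inter h2

theorem ConvexNear.iInter_lt {S : ℕ → Set Plane} {p : Plane} {k : ℕ}
    (h : ∀ j < k, ConvexNear (S j) p) : ConvexNear {z | ∀ j < k, z ∈ S j} p := by
  have := (Set.finite_lt_nat k).eventually_all.2 h
  filter_upwards [this] with r hr
  have heq : {z | ∀ j < k, z ∈ S j} ∩ Metric.closedBall p r =
      {z | ∀ j < k, z ∈ S j ∩ Metric.closedBall p r} ∩ Metric.closedBall p r := by
    ext z
    simp only [mem_inter_iff, mem_ofPred_eq]
    exact ⟨fun h => ⟨fun j hj => ⟨h.1 j hj, h.2⟩, h.2⟩, fun h => ⟨fun j hj => (h.1 j hj).1, h.2⟩⟩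
  rw [heq]
  refine Convex.inter ?_ (convex_closedBall p r)
  simp only [ofPred_forall]
  exact convex_iInter fun j => convex_iInter fun hj => hr j hj

/-! ### Vertices and edges of the comb -/

namespace Comb

/-- The vertices of the comb with `k` teeth: three vertices for each tooth,
and further vertices on the base. -/
noncomputable def vtx (k i : ℕ) : Plane :=
  if i < 3 * k then
    if i % 3 = 0 then !₂[4 * ((i / 3 : ℕ) : ℝ), 0]
    else if i % 3 = 1 then !₂[4 * ((i / 3 : ℕ) : ℝ) + 3, 2]
    else !₂[4 * ((i / 3 : ℕ) : ℝ) + 1, 1]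
  -- Points of the base line x + 6y = 0, from right to left. The last descending edge, on x + 3y =
  -- 4k, meets that line at x = 8k.
  else !₂[8 * (k : ℝ) - ((i - 3 * k : ℕ) : ℝ), -(8 * (k : ℝ) - ((i - 3 * k : ℕ) : ℝ)) / 6]

/-- The convex corners of the comb that are not vertices. -/
noncomputable def bend (k i : ℕ) : Plane :=
  if i % 3 = 0 then !₂[4 * ((i / 3 : ℕ) : ℝ), 2] else !₂[8 * (k : ℝ), -(8 * (k : ℝ)) / 6]

/-- The edges that consist of two line segments. -/
def IsBent (k n i : ℕ) : Prop := i < 3 * k ∧ (i % 3 = 0 ∨ i + 1 = n)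

open Classical in
/-- The edges of the comb with `k` teeth and `n` vertices, as sets. -/
noncomputable def side (k n i : ℕ) : Set Plane :=
  -- For n ≥ 3k, the clause `i + 1 = n` of `IsBent` applies only if n = 3k: the lower right corner
  -- is then a bend of the last edge instead of a vertex.
  if IsBent k n i then
    segment ℝ (vtx k i) (bend k i) ∪ segment ℝ (bend k i) (vtx k ((i + 1) % n))
  else segment ℝ (vtx k i) (vtx k ((i + 1) % n))

section coordinates

variable {k j : ℕ}

theorem vtx_three_mul (h : j < k) : vtx k (3 * j) = !₂[4 * (j : ℝ), 0] := by
  rw [vtx, if_pos (by omega), if_pos (by omega), show 3 * j / 3 = j by omega]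

theorem vtx_three_mul_add_one (h : j < k) : vtx k (3 * j + 1) = !₂[4 * (j : ℝ) + 3, 2] := by
  rw [vtx, if_pos (by omega), if_neg (by omega), if_pos (by omega),
    show (3 * j + 1) / 3 = j by omega]

theorem vtx_three_mul_add_two (h : j < k) : vtx k (3 * j + 2) = !₂[4 * (j : ℝ) + 1, 1] := by
  rw [vtx, if_pos (by omega), if_neg (by omega), if_neg (by omega),
    show (3 * j + 2) / 3 = j by omega]

theorem vtx_base (k s : ℕ) :
    vtx k (3 * k + s) = !₂[8 * (k : ℝ) - s, -(8 * (k : ℝ) - s) / 6] := by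
  rw [vtx, if_neg (by omega), show 3 * k + s - 3 * k = s by omega]

theorem bend_three_mul (k j : ℕ) : bend k (3 * j) = !₂[4 * (j : ℝ), 2] := by
  rw [bend, if_pos (by omega), show 3 * j / 3 = j by omega]

theorem bend_of_ne {i : ℕ} (h : i % 3 ≠ 0) :
    bend k i = !₂[8 * (k : ℝ), -(8 * (k : ℝ)) / 6] := by
  rw [bend, if_neg h]

end coordinates

section sides

variable {k n j : ℕ} {z : Plane}

theorem mem_side_three_mul (hn : 3 * k ≤ n) (h : j < k) :
    z ∈ side k n (3 * j) ↔ (z 0 = 4 * j ∧ 0 ≤ z 1 ∧ z 1 ≤ 2) ∨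
      (4 * j ≤ z 0 ∧ z 0 ≤ 4 * j + 3 ∧ z 1 = 2) := by
  rw [side, if_pos ⟨by omega, .inl (by omega)⟩, Nat.mod_eq_of_lt (by omega), vtx_three_mul h,
    vtx_three_mul_add_one h, bend_three_mul, mem_union,
    Plane.mem_segment_iff_of_vertical (by simp) (by simp),
    Plane.mem_segment_iff_of_lt 0 2 (by simp) (by simp) (by simp)]
  simp

theorem mem_side_three_mul_add_one (hn : 3 * k ≤ n) (h : j < k) :
    z ∈ side k n (3 * j + 1) ↔
      4 * j + 1 ≤ z 0 ∧ z 0 ≤ 4 * j + 3 ∧ 2 * z 1 = z 0 - 4 * j + 1 := by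
  rw [side, if_neg (by unfold IsBent; omega), Nat.mod_eq_of_lt (by omega),
    vtx_three_mul_add_one h, vtx_three_mul_add_two h, segment_symm,
    Plane.mem_segment_iff_of_lt (1 / 2) (1 / 2 - 2 * j) (by simp) (by simp; ring) (by simp; ring)]
  simp only [Matrix.cons_val_zero]
  refine and_congr_right fun _ => and_congr_right fun _ => ?_
  constructor <;> intro h <;> linarith

theorem mem_side_three_mul_add_two (hn : 3 * k ≤ n) (h : j + 1 < k) :
    z ∈ side k n (3 * j + 2) ↔
      4 * j + 1 ≤ z 0 ∧ z 0 ≤ 4 * j + 4 ∧ z 0 + 3 * z 1 = 4 * j + 4 := by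
  rw [side, if_neg (by unfold IsBent; omega), Nat.mod_eq_of_lt (by omega),
    vtx_three_mul_add_two (by omega), show 3 * j + 2 + 1 = 3 * (j + 1) by ring, vtx_three_mul h,
    Plane.mem_segment_iff_of_lt (-1 / 3) ((4 * j + 4) / 3) (by simp; linarith) (by simp; ring)
      (by simp; ring)]
  simp only [Matrix.cons_val_zero]
  push_cast
  rw [show 4 * ((j : ℝ) + 1) = 4 * j + 4 by ring]
  refine and_congr_right fun _ => and_congr_right fun _ => ?_
  constructor <;> intro h <;> linarith

theorem mem_side_close_of_lt (hn : 3 * k < n) (h : j + 1 = k) :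
    z ∈ side k n (3 * j + 2) ↔
      4 * j + 1 ≤ z 0 ∧ z 0 ≤ 8 * k ∧ z 0 + 3 * z 1 = 4 * j + 4 := by
  have hk : (j : ℝ) + 1 = k := by exact_mod_cast h
  have hj : (0 : ℝ) ≤ j := j.cast_nonneg
  rw [side, if_neg (by unfold IsBent; omega), Nat.mod_eq_of_lt (by omega),
    vtx_three_mul_add_two (by omega), show 3 * j + 2 + 1 = 3 * k + 0 by omega, vtx_base,
    Plane.mem_segment_iff_of_lt (-1 / 3) ((4 * j + 4) / 3) (by simp; linarith) (by simp; ring)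
      (by simp; linarith)]
  simp only [Matrix.cons_val_zero, Nat.cast_zero, sub_zero]
  refine and_congr_right fun _ => and_congr_right fun _ => ?_
  constructor <;> intro h <;> linarith

theorem mem_side_close_of_eq (hn : n = 3 * k) (h : j + 1 = k) :
    z ∈ side k n (3 * j + 2) ↔
      (4 * j + 1 ≤ z 0 ∧ z 0 ≤ 8 * k ∧ z 0 + 3 * z 1 = 4 * j + 4) ∨
      (0 ≤ z 0 ∧ z 0 ≤ 8 * k ∧ z 0 + 6 * z 1 = 0) := by
  have hk : (j : ℝ) + 1 = k := by exact_mod_cast h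
  have hj : (0 : ℝ) ≤ j := j.cast_nonneg
  rw [side, if_pos ⟨by omega, .inr (by omega)⟩, show (3 * j + 2 + 1) % n = 3 * 0 by
    rw [hn, show 3 * j + 2 + 1 = 3 * k by omega, Nat.mod_self],
    vtx_three_mul_add_two (by omega), bend_of_ne (by omega), vtx_three_mul (by omega), mem_union,
    Plane.mem_segment_iff_of_lt (-1 / 3) ((4 * j + 4) / 3) (by simp; linarith) (by simp; ring)
      (by simp; linarith), segment_symm,
    Plane.mem_segment_iff_of_lt (-1 / 6) 0 (by simp; linarith) (by simp) (by simp; ring)]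
  simp only [Matrix.cons_val_zero, Nat.cast_zero, mul_zero]
  refine or_congr (and_congr_right fun _ => and_congr_right fun _ => ?_)
    (and_congr_right fun _ => and_congr_right fun _ => ?_) <;>
  constructor <;> intro h <;> linarith

theorem mem_side_base_of_lt {s : ℕ} (h : 3 * k + s + 1 < n) :
    z ∈ side k n (3 * k + s) ↔
      8 * k - s - 1 ≤ z 0 ∧ z 0 ≤ 8 * k - s ∧ z 0 + 6 * z 1 = 0 := by
  rw [side, if_neg (by unfold IsBent; omega), Nat.mod_eq_of_lt (by omega), add_assoc, vtx_base,
    vtx_base, segment_symm,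
    Plane.mem_segment_iff_of_lt (-1 / 6) 0 (by simp) (by simp; ring) (by simp; ring)]
  simp only [Matrix.cons_val_zero]
  push_cast
  rw [sub_sub]
  refine and_congr_right fun _ => and_congr_right fun _ => ?_
  constructor <;> intro h <;> linarith

theorem mem_side_base_of_eq {s : ℕ} (hk : 0 < k) (hs : s ≤ 1) (h : 3 * k + s + 1 = n) :
    z ∈ side k n (3 * k + s) ↔
      0 ≤ z 0 ∧ z 0 ≤ 8 * k - s ∧ z 0 + 6 * z 1 = 0 := by
  have hk' : (1 : ℝ) ≤ k := by exact_mod_cast hk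
  have hs' : (s : ℝ) ≤ 1 := by exact_mod_cast hs
  rw [side, if_neg (by unfold IsBent; omega), h, Nat.mod_self, vtx_base,
    show vtx k 0 = _ from vtx_three_mul hk, segment_symm,
    Plane.mem_segment_iff_of_lt (-1 / 6) 0 (by simp; linarith) (by simp) (by simp; ring)]
  simp only [Matrix.cons_val_zero, Nat.cast_zero, mul_zero]
  refine and_congr_right fun _ => and_congr_right fun _ => ?_
  constructor <;> intro h <;> linarith

theorem index_cases {i : ℕ} (hn : 3 * k ≤ n) (hn2 : n ≤ 3 * k + 2) (hi : i < n) :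
    (∃ j < k, i = 3 * j) ∨ (∃ j < k, i = 3 * j + 1) ∨ (∃ j, j + 1 < k ∧ i = 3 * j + 2) ∨
    (∃ j, j + 1 = k ∧ i = 3 * j + 2 ∧ 3 * k < n) ∨ (∃ j, j + 1 = k ∧ i = 3 * j + 2 ∧ n = 3 * k) ∨
    (∃ s, s ≤ 1 ∧ i = 3 * k + s ∧ 3 * k + s + 1 < n) ∨
    (∃ s, s ≤ 1 ∧ i = 3 * k + s ∧ 3 * k + s + 1 = n) := by
  by_cases h : i < 3 * k
  · have : i = 3 * (i / 3) ∨ i = 3 * (i / 3) + 1 ∨ i = 3 * (i / 3) + 2 := by omega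
    have hik : i / 3 < k := by omega
    rcases this with h0 | h1 | h2
    · exact .inl ⟨_, hik, h0⟩
    · exact .inr (.inl ⟨_, hik, h1⟩)
    · by_cases hl : i / 3 + 1 < k
      · exact .inr (.inr (.inl ⟨_, hl, h2⟩))
      · by_cases hn3 : 3 * k < n
        · exact .inr (.inr (.inr (.inl ⟨i / 3, by omega, h2, hn3⟩)))
        · exact .inr (.inr (.inr (.inr (.inl ⟨i / 3, by omega, h2, by omega⟩))))
  · by_cases hl : i + 1 < n
    · exact .inr (.inr (.inr (.inr (.inr (.inl ⟨i - 3 * k, by omega, by omega, by omega⟩)))))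
    · exact .inr (.inr (.inr (.inr (.inr (.inr ⟨i - 3 * k, by omega, by omega, by omega⟩)))))

/-- What it means for a point to lie on an edge, with the coordinates of the end points. -/
theorem side_cases {i : ℕ} (hk : 0 < k) (hn : 3 * k ≤ n) (hn2 : n ≤ 3 * k + 2) (hi : i < n)
    (hz : z ∈ side k n i) :
    (∃ j : ℕ, (i = 3 * j ∧ j < k) ∧ (j : ℝ) + 1 ≤ k ∧
      ((z 0 = 4 * j ∧ 0 ≤ z 1 ∧ z 1 ≤ 2) ∨ (4 * j ≤ z 0 ∧ z 0 ≤ 4 * j + 3 ∧ z 1 = 2)) ∧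
      vtx k i 0 = 4 * j ∧ vtx k i 1 = 0 ∧
      vtx k ((i + 1) % n) 0 = 4 * j + 3 ∧ vtx k ((i + 1) % n) 1 = 2) ∨
    (∃ j : ℕ, (i = 3 * j + 1 ∧ j < k) ∧ (j : ℝ) + 1 ≤ k ∧
      (4 * j + 1 ≤ z 0 ∧ z 0 ≤ 4 * j + 3 ∧ 2 * z 1 = z 0 - 4 * j + 1) ∧
      vtx k i 0 = 4 * j + 3 ∧ vtx k i 1 = 2 ∧
      vtx k ((i + 1) % n) 0 = 4 * j + 1 ∧ vtx k ((i + 1) % n) 1 = 1) ∨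
    (∃ j : ℕ, (i = 3 * j + 2 ∧ j + 1 < k) ∧ (j : ℝ) + 2 ≤ k ∧
      (4 * j + 1 ≤ z 0 ∧ z 0 ≤ 4 * j + 4 ∧ z 0 + 3 * z 1 = 4 * j + 4) ∧
      vtx k i 0 = 4 * j + 1 ∧ vtx k i 1 = 1 ∧
      vtx k ((i + 1) % n) 0 = 4 * j + 4 ∧ vtx k ((i + 1) % n) 1 = 0) ∨
    (∃ j : ℕ, (i = 3 * j + 2 ∧ j + 1 = k ∧ 3 * k < n) ∧ (j : ℝ) + 1 = k ∧
      (4 * j + 1 ≤ z 0 ∧ z 0 ≤ 8 * k ∧ z 0 + 3 * z 1 = 4 * j + 4) ∧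
      vtx k i 0 = 4 * j + 1 ∧ vtx k i 1 = 1 ∧
      vtx k ((i + 1) % n) 0 = 8 * k ∧ vtx k ((i + 1) % n) 1 = -(8 * k) / 6) ∨
    (∃ j : ℕ, (i = 3 * j + 2 ∧ j + 1 = k ∧ n = 3 * k) ∧ (j : ℝ) + 1 = k ∧
      ((4 * j + 1 ≤ z 0 ∧ z 0 ≤ 8 * k ∧ z 0 + 3 * z 1 = 4 * j + 4) ∨
      (0 ≤ z 0 ∧ z 0 ≤ 8 * k ∧ z 0 + 6 * z 1 = 0)) ∧
      vtx k i 0 = 4 * j + 1 ∧ vtx k i 1 = 1 ∧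
      vtx k ((i + 1) % n) 0 = 0 ∧ vtx k ((i + 1) % n) 1 = 0) ∨
    (∃ j : ℕ, (i = 3 * k + j ∧ 3 * k + j + 1 < n) ∧ (j : ℝ) ≤ 1 ∧
      (8 * k - j - 1 ≤ z 0 ∧ z 0 ≤ 8 * k - j ∧ z 0 + 6 * z 1 = 0) ∧
      vtx k i 0 = 8 * k - j ∧ vtx k i 1 = -(8 * k - j) / 6 ∧
      vtx k ((i + 1) % n) 0 = 8 * k - j - 1 ∧ vtx k ((i + 1) % n) 1 = -(8 * k - j - 1) / 6) ∨
    (∃ j : ℕ, (i = 3 * k + j ∧ 3 * k + j + 1 = n) ∧ (j : ℝ) ≤ 1 ∧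
      (0 ≤ z 0 ∧ z 0 ≤ 8 * k - j ∧ z 0 + 6 * z 1 = 0) ∧
      vtx k i 0 = 8 * k - j ∧ vtx k i 1 = -(8 * k - j) / 6 ∧
      vtx k ((i + 1) % n) 0 = 0 ∧ vtx k ((i + 1) % n) 1 = 0) := by
  have h0 : vtx k 0 = !₂[0, 0] := by simpa using vtx_three_mul (j := 0) hk
  rcases index_cases hn hn2 hi with ⟨j, hj, rfl⟩ | ⟨j, hj, rfl⟩ | ⟨j, hj, rfl⟩ |
    ⟨j, hj, rfl, h⟩ | ⟨j, hj, rfl, h⟩ | ⟨j, hj, rfl, h⟩ | ⟨j, hj, rfl, h⟩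
  · refine .inl ⟨j, ⟨rfl, hj⟩, by exact_mod_cast hj, (mem_side_three_mul hn hj).1 hz, ?_⟩
    rw [Nat.mod_eq_of_lt (by omega), vtx_three_mul hj, vtx_three_mul_add_one hj]
    simp
  · refine .inr (.inl ⟨j, ⟨rfl, hj⟩, by exact_mod_cast hj,
      (mem_side_three_mul_add_one hn hj).1 hz, ?_⟩)
    rw [Nat.mod_eq_of_lt (by omega), vtx_three_mul_add_one hj, vtx_three_mul_add_two hj]
    simp
  · refine .inr (.inr (.inl ⟨j, ⟨rfl, hj⟩, by exact_mod_cast hj,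
      (mem_side_three_mul_add_two hn hj).1 hz, ?_⟩))
    rw [Nat.mod_eq_of_lt (by omega), vtx_three_mul_add_two (by omega),
      show 3 * j + 2 + 1 = 3 * (j + 1) by ring, vtx_three_mul hj]
    simp
    ring
  · refine .inr (.inr (.inr (.inl ⟨j, ⟨rfl, hj, h⟩, by exact_mod_cast hj,
      (mem_side_close_of_lt h hj).1 hz, ?_⟩)))
    rw [Nat.mod_eq_of_lt (by omega), vtx_three_mul_add_two (by omega),
      show 3 * j + 2 + 1 = 3 * k + 0 by omega, vtx_base]
    simp
  · refine .inr (.inr (.inr (.inr (.inl ⟨j, ⟨rfl, hj, h⟩, by exact_mod_cast hj,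
      (mem_side_close_of_eq h hj).1 hz, ?_⟩))))
    rw [show (3 * j + 2 + 1) % n = 0 by
      rw [h, show 3 * j + 2 + 1 = 3 * k by omega, Nat.mod_self], vtx_three_mul_add_two (by omega),
      h0]
    simp
  · refine .inr (.inr (.inr (.inr (.inr (.inl ⟨j, ⟨rfl, h⟩, by exact_mod_cast hj,
      (mem_side_base_of_lt h).1 hz, ?_⟩)))))
    rw [Nat.mod_eq_of_lt (by omega), vtx_base, add_assoc, vtx_base]
    simp
    constructor <;> ring
  · refine .inr (.inr (.inr (.inr (.inr (.inr ⟨j, ⟨rfl, h⟩, by exact_mod_cast hj,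
      (mem_side_base_of_eq hk hj h).1 hz, ?_⟩)))))
    rw [h, Nat.mod_self, vtx_base, h0]
    simp

end sides

/-! ### The comb is a curvilinear polygon -/

-- Used in both orders of the two edges, this shows that a common point is an end point of each.
set_option maxHeartbeats 8000000 in
theorem side_inter {i i' : ℕ} {z : Plane} (hk : 0 < k) (hn : 3 * k ≤ n) (hn2 : n ≤ 3 * k + 2)
    (hi : i < n) (hi' : i' < n) (hne : i ≠ i') (hz : z ∈ side k n i) (hz' : z ∈ side k n i') :
    z = vtx k i ∨ z = vtx k ((i + 1) % n) := by
  have hk1 : (1 : ℝ) ≤ k := by exact_mod_cast hk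
  suffices h : (z 0 = vtx k i 0 ∧ z 1 = vtx k i 1) ∨
      (z 0 = vtx k ((i + 1) % n) 0 ∧ z 1 = vtx k ((i + 1) % n) 1) from
    h.imp (fun h => Plane.ext h.1 h.2) fun h => Plane.ext h.1 h.2
  have B := side_cases hk hn hn2 hi' hz'
  rcases side_cases hk hn hn2 hi hz with ⟨j, a1, a2, a3 | a3, v1, v2, v3, v4⟩ |
    ⟨j, a1, a2, a3, v1, v2, v3, v4⟩ | ⟨j, a1, a2, a3, v1, v2, v3, v4⟩ |
    ⟨j, a1, a2, a3, v1, v2, v3, v4⟩ | ⟨j, a1, a2, a3 | a3, v1, v2, v3, v4⟩ |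
    ⟨j, a1, a2, a3, v1, v2, v3, v4⟩ | ⟨j, a1, a2, a3, v1, v2, v3, v4⟩ <;>
  rw [v1, v2, v3, v4] <;> clear v1 v2 v3 v4 hz hz' <;>
  obtain ⟨a4, a5, a6⟩ := a3 <;>
  have hj0 : (0 : ℝ) ≤ j := j.cast_nonneg <;>
  rcases B with ⟨j', b1, b2, b3 | b3, -⟩ |
    ⟨j', b1, b2, b3, -⟩ | ⟨j', b1, b2, b3, -⟩ |
    ⟨j', b1, b2, b3, -⟩ | ⟨j', b1, b2, b3 | b3, -⟩ |
    ⟨j', b1, b2, b3, -⟩ | ⟨j', b1, b2, b3, -⟩ <;>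
  obtain ⟨b4, b5, b6⟩ := b3 <;>
  have hj0' : (0 : ℝ) ≤ j' := j'.cast_nonneg <;>
  -- Comparing the indices turns the spacing of the teeth into a linear inequality; each pair of
  -- edge pieces is then a problem of linear arithmetic.
  rcases lt_trichotomy j j' with hjj | hjj | hjj <;>
  first
  | (exfalso; omega)
  | (have hc : (j : ℝ) + 1 ≤ j' := by exact_mod_cast hjj
     first
     | (exfalso; linarith)
     | (left; constructor <;> linarith)
     | (right; constructor <;> linarith))
  | (have hc : (j' : ℝ) + 1 ≤ j := by exact_mod_cast hjj
     first
     | (exfalso; linarith)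
     | (left; constructor <;> linarith)
     | (right; constructor <;> linarith))
  | (have hc : (j : ℝ) = j' := by exact_mod_cast hjj
     first
     | (exfalso; linarith)
     | (left; constructor <;> linarith)
     | (right; constructor <;> linarith))

theorem vtx_injOn (hk : 0 < k) (hn2 : n ≤ 3 * k + 2) {i i' : ℕ} (hi : i < n) (hi' : i' < n)
    (h : vtx k i = vtx k i') : i = i' := by
  have key : ∀ i < n, (∃ j < k, i = 3 * j ∧ vtx k i = !₂[4 * (j : ℝ), 0]) ∨
      (∃ j < k, i = 3 * j + 1 ∧ vtx k i = !₂[4 * (j : ℝ) + 3, 2]) ∨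
      (∃ j < k, i = 3 * j + 2 ∧ vtx k i = !₂[4 * (j : ℝ) + 1, 1]) ∨
      (∃ s ≤ 1, i = 3 * k + s ∧ vtx k i = !₂[8 * (k : ℝ) - s, -(8 * (k : ℝ) - s) / 6]) := by
    intro i hi
    by_cases hik : i < 3 * k
    · have hjk : i / 3 < k := by omega
      have : i = 3 * (i / 3) ∨ i = 3 * (i / 3) + 1 ∨ i = 3 * (i / 3) + 2 := by omega
      rcases this with h | h | h
      · exact .inl ⟨_, hjk, h, by rw [← vtx_three_mul hjk, ← h]⟩
      · exact .inr (.inl ⟨_, hjk, h, by rw [← vtx_three_mul_add_one hjk, ← h]⟩)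
      · exact .inr (.inr (.inl ⟨_, hjk, h, by rw [← vtx_three_mul_add_two hjk, ← h]⟩))
    · have h : i = 3 * k + (i - 3 * k) := by omega
      exact .inr (.inr (.inr ⟨_, by omega, h, by rw [← vtx_base, ← h]⟩))
  have hk' : (1 : ℝ) ≤ k := by exact_mod_cast hk
  have h0 : vtx k i 0 = vtx k i' 0 := by rw [h]
  have h1 : vtx k i 1 = vtx k i' 1 := by rw [h]
  rcases key i hi with ⟨j, hj, rfl, e⟩ | ⟨j, hj, rfl, e⟩ | ⟨j, hj, rfl, e⟩ | ⟨j, hj, rfl, e⟩ <;>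
  rcases key i' hi' with ⟨j', hj', rfl, e'⟩ | ⟨j', hj', rfl, e'⟩ | ⟨j', hj', rfl, e'⟩ |
    ⟨j', hj', rfl, e'⟩ <;>
  rw [e, e'] at h0 h1 <;>
  simp at h0 h1 <;>
  first
  | rw [h0]
  | (have hs : (j : ℝ) ≤ 1 := by exact_mod_cast hj
     exfalso; linarith)
  | (have hs : (j' : ℝ) ≤ 1 := by exact_mod_cast hj'
     exfalso; linarith)

theorem not_collinear_of_isBent (hn : 3 * k ≤ n) {i : ℕ} (h : IsBent k n i) :
    ¬ Collinear ℝ ({vtx k i, bend k i, vtx k ((i + 1) % n)} : Set Plane) := by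
  apply Plane.not_collinear_triple
  obtain ⟨hi, h | h⟩ := h
  · obtain ⟨j, rfl⟩ : ∃ j, i = 3 * j := ⟨i / 3, by omega⟩
    rw [Nat.mod_eq_of_lt (by omega), vtx_three_mul (by omega), vtx_three_mul_add_one (by omega),
      bend_three_mul]
    norm_num
  · obtain ⟨j, rfl⟩ : ∃ j, i = 3 * j + 2 := ⟨i / 3, by omega⟩
    have hk : (j : ℝ) + 1 = k := by
      have : j + 1 = k := by omega
      exact_mod_cast this
    have hj : (0 : ℝ) ≤ j := j.cast_nonneg
    rw [show (3 * j + 2 + 1) % n = 3 * 0 by rw [h, Nat.mod_self], vtx_three_mul_add_two (by omega),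
      bend_of_ne (by omega), vtx_three_mul (by omega), ← hk]
    norm_num
    intro h
    nlinarith

theorem _root_.Fin.val_add_one_eq_mod [NeZero n] (i : Fin n) :
    ((i + 1 : Fin n) : ℕ) = ((i : ℕ) + 1) % n := by
  rw [Fin.val_add, Fin.coe_ofNat_eq_mod, Nat.add_mod_mod]

theorem ne_bend_of_isBent (hn : 3 * k ≤ n) {i : ℕ} (h : IsBent k n i) :
    vtx k i ≠ bend k i ∧ bend k i ≠ vtx k ((i + 1) % n) := by
  have := not_collinear_of_isBent hn h
  constructor <;> intro he <;> apply this <;> simp [he, collinear_pair]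

open Classical in
/-- The edges of the comb with `k` teeth and `n` vertices, as paths. -/
noncomputable def arc (k n : ℕ) [NeZero n] (i : Fin n) : Path (vtx k i) (vtx k (i + 1 : Fin n)) :=
  if IsBent k n i then
    (Path.segment (vtx k i) (bend k i)).trans (Path.segment (bend k i) (vtx k (i + 1 : Fin n)))
  else Path.segment (vtx k i) (vtx k (i + 1 : Fin n))

theorem range_arc [NeZero n] (i : Fin n) : range (arc k n i) = side k n i := by
  simp only [arc, side, ← Fin.val_add_one_eq_mod]
  split_ifs
  · rw [Path.trans_range, Path.range_segment, Path.range_segment]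
  · rw [Path.range_segment]

/-- The comb with `k` teeth, as a curvilinear polygon with `n` vertices. -/
noncomputable def polygon (k n : ℕ) [NeZero n] (hk : 0 < k) (hn : 3 * k ≤ n)
    (hn2 : n ≤ 3 * k + 2) : CurvilinearPolygon n :=
  { vertex := fun i => vtx k i
    vertex_injective := fun i j h => Fin.ext (vtx_injOn hk hn2 i.2 j.2 h)
    arc := arc k n
    arc_injective := by
      intro i
      simp only [arc]
      split_ifs with h
      · have hb := ne_bend_of_isBent hn h
        have hc := not_collinear_of_isBent hn h
        rw [← Fin.val_add_one_eq_mod] at hb hc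
        refine Path.trans_injective (Path.segment_injective hb.1) (Path.segment_injective hb.2) ?_
        rw [Path.range_segment, Path.range_segment]
        exact segment_inter_segment_of_not_collinear hc
      · refine Path.segment_injective fun he => ?_
        have := vtx_injOn hk hn2 i.2 (i + 1 : Fin n).2 he
        rw [Fin.val_add_one_eq_mod] at this
        by_cases hi : (i : ℕ) + 1 < n
        · rw [Nat.mod_eq_of_lt hi] at this
          omega
        · rw [show (i : ℕ) + 1 = n by omega, Nat.mod_self] at this
          omega
    arc_inter := by
      intro i j hij
      have hij' : (i : ℕ) ≠ j := fun h => hij (Fin.ext h)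
      apply Subset.antisymm
      · rintro z ⟨hz, hz'⟩
        rw [range_arc] at hz hz'
        rw [Fin.val_add_one_eq_mod, Fin.val_add_one_eq_mod]
        exact ⟨side_inter hk hn hn2 i.2 j.2 hij' hz hz',
          side_inter hk hn hn2 j.2 i.2 hij'.symm hz' hz⟩
      · have hsub : ∀ i : Fin n, {vtx k i, vtx k (i + 1 : Fin n)} ⊆ range (arc k n i) := by
          rintro i z (rfl | rfl)
          · exact ⟨0, (arc k n i).source⟩
          · exact ⟨1, (arc k n i).target⟩
        exact inter_subset_inter (hsub i) (hsub j) }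

section polygon

variable [NeZero n] (hk : 0 < k) (hn : 3 * k ≤ n) (hn2 : n ≤ 3 * k + 2)

theorem edge_polygon (i : Fin n) : (polygon k n hk hn hn2).edge i = side k n i :=
  range_arc i

theorem isConvexArc_edge (i : Fin n) : IsConvexArc ((polygon k n hk hn hn2).edge i) := by
  rw [edge_polygon, side]
  split_ifs with h
  · exact isConvexArc_segment_union_segment (not_collinear_of_isBent hn h)
  · exact isConvexArc_segment _ _

theorem mem_boundary_polygon {z : Plane} :
    z ∈ (polygon k n hk hn hn2).boundary ↔ ∃ i < n, z ∈ side k n i := by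
  simp only [CurvilinearPolygon.boundary, mem_iUnion, edge_polygon]
  exact ⟨fun ⟨i, hi⟩ => ⟨i, i.2, hi⟩, fun ⟨i, hi, h⟩ => ⟨⟨i, hi⟩, h⟩⟩

end polygon

/-! ### The region of the comb -/

/-- The open gap to the right of the `j`-th tooth. -/
def gap (k j : ℕ) : Set Plane :=
  -- Bounded by the lines BC and CA' (A' the foot of the next tooth) and by the wall of the next
  -- tooth, which is absent for the last tooth.
  {z | 2 * z 1 < z 0 - 4 * j + 1 ∧ 4 * j + 4 < z 0 + 3 * z 1 ∧ (j + 1 < k → z 0 < 4 * j + 4)}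

/-- The region of the comb with `k` teeth. -/
def body (k : ℕ) : Set Plane :=
  {z | 0 ≤ z 0 ∧ z 1 ≤ 2 ∧ 0 ≤ z 0 + 6 * z 1} ∩ {z | ∀ j < k, z ∈ (gap k j)ᶜ}

theorem not_mem_gap_iff {j : ℕ} {z : Plane} : z ∈ (gap k j)ᶜ ↔
    z 0 - 4 * j + 1 ≤ 2 * z 1 ∨ z 0 + 3 * z 1 ≤ 4 * j + 4 ∨ (j + 1 < k ∧ 4 * j + 4 ≤ z 0) := by
  simp only [gap, mem_compl_iff, mem_ofPred_eq, not_and_or, not_lt, Classical.not_imp]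

theorem side_subset_body {i : ℕ} (hk : 0 < k) (hn : 3 * k ≤ n) (hn2 : n ≤ 3 * k + 2)
    (hi : i < n) : side k n i ⊆ body k := by
  intro z hz
  have hk1 : (1 : ℝ) ≤ k := by exact_mod_cast hk
  rcases side_cases hk hn hn2 hi hz with ⟨j, a1, a2, a3 | a3, -⟩ |
    ⟨j, a1, a2, a3, -⟩ | ⟨j, a1, a2, a3, -⟩ |
    ⟨j, a1, a2, a3, -⟩ | ⟨j, a1, a2, a3 | a3, -⟩ |
    ⟨j, a1, a2, a3, -⟩ | ⟨j, a1, a2, a3, -⟩ <;>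
  obtain ⟨a4, a5, a6⟩ := a3 <;>
  have hj0 : (0 : ℝ) ≤ j := j.cast_nonneg <;>
  refine ⟨⟨by linarith, by linarith, by linarith⟩, ?_⟩ <;>
  rintro j' hj' ⟨b1, b2, b3⟩ <;>
  have hj0' : (0 : ℝ) ≤ j' := j'.cast_nonneg <;>
  (have hjk' : (j' : ℝ) + 1 ≤ k := by exact_mod_cast hj') <;>
  rcases lt_or_ge j' j with hjj | hjj <;>
  first
  | (have hc : (j' : ℝ) + 1 ≤ j := by exact_mod_cast hjj
     have := b3 (by omega)
     linarith)
  | (have hc : (j : ℝ) ≤ j' := by exact_mod_cast hjj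
     linarith)
  | (rcases (show j' + 1 < k ∨ j' + 1 = k by omega) with h | h
     · have := b3 h
       linarith
     · have h : (j' : ℝ) + 1 = k := by exact_mod_cast h
       linarith)

theorem isClosed_body (k : ℕ) : IsClosed (body k) := by
  have h0 : Continuous fun z : Plane => z 0 := by fun_prop
  have h1 : Continuous fun z : Plane => z 1 := by fun_prop
  refine IsClosed.inter ?_ ?_
  · exact (isClosed_le continuous_const h0).inter ((isClosed_le h1 continuous_const).inter
      (isClosed_le continuous_const (h0.add (continuous_const.mul h1))))
  · simp only [ofPred_forall]
    refine isClosed_iInter fun j => isClosed_iInter fun _ => IsOpen.isClosed_compl ?_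
    refine IsOpen.inter (isOpen_lt (continuous_const.mul h1)
      ((h0.sub continuous_const).add continuous_const)) (IsOpen.inter
      (isOpen_lt continuous_const (h0.add (continuous_const.mul h1))) ?_)
    by_cases h : j + 1 < k
    · simp only [h, forall_const]
      exact isOpen_lt h0 continuous_const
    · simp only [h, IsEmpty.forall_iff]
      exact isOpen_univ

/-- The last gap has no right wall. Outside it, either x ≤ 4k − 5 + 2y with y ≤ 2, or x = 2(x + 3y)
− (x + 6y) ≤ 8k. -/
theorem le_of_mem_body (hk : 0 < k) {z : Plane} (hz : z ∈ body k) : z 0 ≤ 8 * k := by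
  obtain ⟨⟨h0, h1, h2⟩, h3⟩ := hz
  have hk' : (((k - 1 : ℕ) : ℝ)) = k - 1 := by push_cast [Nat.cast_sub hk]; ring
  have hk1 : (1 : ℝ) ≤ k := by exact_mod_cast hk
  rcases not_mem_gap_iff.1 (h3 (k - 1) (by omega)) with h | h | h
  · rw [hk'] at h; linarith
  · rw [hk'] at h; linarith
  · omega

theorem isBounded_body (hk : 0 < k) : Bornology.IsBounded (body k) := by
  rw [isBounded_iff_forall_norm_le]
  refine ⟨√((8 * k) ^ 2 + (2 + 8 * k) ^ 2), fun z hz => ?_⟩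
  have hx := le_of_mem_body hk hz
  obtain ⟨⟨h0, h1, h2⟩, -⟩ := hz
  have hk1 : (1 : ℝ) ≤ k := by exact_mod_cast hk
  rw [EuclideanSpace.norm_eq, Fin.sum_univ_two]
  refine Real.sqrt_le_sqrt (add_le_add (sq_le_sq' ?_ ?_) (sq_le_sq' ?_ ?_)) <;>
  first
  | exact abs_le.2 ⟨by linarith, by linarith⟩
  | linarith [norm_nonneg (z 0), norm_nonneg (z 1)]

theorem compl_gap_mem_nhds {j : ℕ} {z : Plane}
    (h : z 0 - 4 * j + 1 < 2 * z 1 ∨ z 0 + 3 * z 1 < 4 * j + 4 ∨ (j + 1 < k ∧ 4 * j + 4 < z 0)) :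
    (gap k j)ᶜ ∈ 𝓝 z := by
  rcases h with h | h | ⟨hjk, h⟩
  · have c : ContinuousAt (fun z : Plane => 2 * z 1 - (z 0 - 4 * j + 1)) z := by fun_prop
    filter_upwards [c.eventually (lt_mem_nhds (sub_pos.2 h))] with w hw
    exact not_mem_gap_iff.2 (.inl (by linarith))
  · have c : ContinuousAt (fun z : Plane => z 0 + 3 * z 1) z := by fun_prop
    filter_upwards [c.eventually (gt_mem_nhds h)] with w hw
    exact not_mem_gap_iff.2 (.inr (.inl hw.le))
  · have c : ContinuousAt (fun z : Plane => z 0) z := by fun_prop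
    filter_upwards [c.eventually (lt_mem_nhds h)] with w hw
    exact not_mem_gap_iff.2 (.inr (.inr ⟨hjk, le_of_lt hw⟩))

/-- Wherever a defining inequality of `body` is tight the point lies on an edge; off the edges the
inequalities are strict and persist nearby. -/
theorem body_mem_nhds (hk : 0 < k) (hn : 3 * k ≤ n) (hn2 : n ≤ 3 * k + 2) {z : Plane}
    (hz : z ∈ body k) (hb : ∀ i < n, z ∉ side k n i) : body k ∈ 𝓝 z := by
  have hxk := le_of_mem_body hk hz
  obtain ⟨⟨h0, h1, h2⟩, h3⟩ := hz
  have hk1 : (1 : ℝ) ≤ k := by exact_mod_cast hk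
  have g0 : 0 < z 0 := by
    refine lt_of_le_of_ne h0 fun h => hb (3 * 0) (by omega) ?_
    exact (mem_side_three_mul hn hk).2 (.inl ⟨by simp [← h], by linarith, h1⟩)
  have g1 : z 1 < 2 := by
    refine lt_of_le_of_ne h1 fun h => ?_
    -- The tooth of a point on y = 2 is ⌊x/4⌋, capped at k − 1.
    obtain ⟨j, hj, hjz, hjz'⟩ : ∃ j < k, 4 * (j : ℝ) ≤ z 0 ∧ (j + 1 < k → z 0 < 4 * j + 4) := by
      have hf := Nat.floor_le (show 0 ≤ z 0 / 4 by positivity)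
      have hf' := Nat.lt_floor_add_one (z 0 / 4)
      by_cases hfk : ⌊z 0 / 4⌋₊ < k
      · exact ⟨_, hfk, by linarith, fun _ => by linarith⟩
      · refine ⟨k - 1, by omega, ?_, fun h => by omega⟩
        have : (((k - 1 : ℕ) : ℝ)) ≤ ⌊z 0 / 4⌋₊ := by exact_mod_cast (by omega)
        linarith
    refine hb (3 * j) (by omega) ((mem_side_three_mul hn hj).2 (.inr ⟨hjz, ?_, h⟩))
    have hj0 : (0 : ℝ) ≤ j := j.cast_nonneg
    rcases not_mem_gap_iff.1 (h3 j hj) with h' | h' | h'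
    · linarith
    · linarith
    · linarith [hjz' h'.1]
  have g2 : 0 < z 0 + 6 * z 1 := by
    refine lt_of_le_of_ne h2 fun h => ?_
    rcases (show n = 3 * k ∨ n = 3 * k + 1 ∨ n = 3 * k + 2 by omega) with hnk | hnk | hnk
    · exact hb (3 * (k - 1) + 2) (by omega)
        ((mem_side_close_of_eq hnk (by omega)).2 (.inr ⟨h0, hxk, h.symm⟩))
    · exact hb (3 * k + 0) (by omega) ((mem_side_base_of_eq hk (by omega) (by omega)).2
        ⟨h0, by simpa using hxk, h.symm⟩)
    · by_cases hx : z 0 ≤ 8 * k - 1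
      · exact hb (3 * k + 1) (by omega) ((mem_side_base_of_eq hk (by omega) (by omega)).2
          ⟨h0, by simpa using hx, h.symm⟩)
      · exact hb (3 * k + 0) (by omega) ((mem_side_base_of_lt (by omega)).2
          ⟨by push_cast; linarith, by simpa using hxk, h.symm⟩)
  have g3 : ∀ j < k, z 0 - 4 * j + 1 < 2 * z 1 ∨ z 0 + 3 * z 1 < 4 * j + 4 ∨
      (j + 1 < k ∧ 4 * j + 4 < z 0) := by
    intro j hj
    have hj0 : (0 : ℝ) ≤ j := j.cast_nonneg
    by_contra! hcon
    obtain ⟨c1, c2, c3⟩ := hcon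
    rcases not_mem_gap_iff.1 (h3 j hj) with h | h | ⟨hjk, h⟩
    · exact hb (3 * j + 1) (by omega) ((mem_side_three_mul_add_one hn hj).2
        ⟨by linarith, by linarith, by linarith⟩)
    · refine hb (3 * j + 2) (by omega) ?_
      rcases (show j + 1 < k ∨ j + 1 = k by omega) with hjk | hjk
      · exact (mem_side_three_mul_add_two hn hjk).2 ⟨by linarith, c3 hjk, by linarith⟩
      · rcases (show n = 3 * k ∨ 3 * k < n by omega) with hnk | hnk
        · exact (mem_side_close_of_eq hnk hjk).2 (.inl ⟨by linarith, hxk, by linarith⟩)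
        · exact (mem_side_close_of_lt hnk hjk).2 ⟨by linarith, hxk, by linarith⟩
    · refine hb (3 * (j + 1)) (by omega) ((mem_side_three_mul hn hjk).2 (.inl ⟨?_, ?_, h1⟩))
      · push_cast; linarith [c3 hjk]
      · linarith [c3 hjk]
  have c0 : ContinuousAt (fun z : Plane => z 0) z := by fun_prop
  have c1 : ContinuousAt (fun z : Plane => z 1) z := by fun_prop
  refine inter_mem (inter_mem ?_ (inter_mem ?_ ?_)) ?_
  · exact (c0.eventually (lt_mem_nhds g0)).mono fun w hw => le_of_lt hw
  · exact (c1.eventually (gt_mem_nhds g1)).mono fun w hw => le_of_lt hw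
  · have : ContinuousAt (fun z : Plane => z 0 + 6 * z 1) z := by fun_prop
    exact (this.eventually (lt_mem_nhds g2)).mono fun w hw => le_of_lt hw
  · refine (Set.finite_lt_nat k).eventually_all.2 fun j hj => ?_
    exact compl_gap_mem_nhds (g3 j hj)

end Comb

theorem Plane.convex_halfPlane_lt (a b c : ℝ) : Convex ℝ {z : Plane | a * z 0 + b * z 1 < c} :=
  convex_halfSpace_lt (f := fun z : Plane => a * z 0 + b * z 1)
    ⟨fun x y => by simp; ring, fun t x => by simp; ring⟩ c

theorem Plane.convex_halfPlane_le (a b c : ℝ) : Convex ℝ {z : Plane | a * z 0 + b * z 1 ≤ c} :=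
  convex_halfSpace_le (f := fun z : Plane => a * z 0 + b * z 1)
    ⟨fun x y => by simp; ring, fun t x => by simp; ring⟩ c

theorem Plane.not_isBounded {S : Set Plane} (h : ∀ R : ℝ, ∃ z ∈ S, ∃ i, R < |z i|) :
    ¬ Bornology.IsBounded S := by
  intro hb
  obtain ⟨R, hR⟩ := hb.exists_norm_le
  obtain ⟨z, hz, i, hi⟩ := h R
  have := PiLp.norm_apply_le z i
  rw [Real.norm_eq_abs] at this
  linarith [hR z hz]

namespace Comb

variable {k n : ℕ}

theorem convex_gap (k j : ℕ) : Convex ℝ (gap k j) := by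
  have h1 := Plane.convex_halfPlane_lt (-1) 2 (1 - 4 * j)
  have h2 := Plane.convex_halfPlane_lt (-1) (-3) (-(4 * j + 4))
  have h3 := Plane.convex_halfPlane_lt 1 0 (4 * j + 4)
  by_cases h : j + 1 < k
  · convert h1.inter (h2.inter h3) using 1
    ext z
    simp only [gap, mem_inter_iff, mem_ofPred_eq, h, forall_const]
    refine and_congr ?_ (and_congr ?_ ?_) <;> constructor <;> intro h <;> linarith
  · convert h1.inter h2 using 1
    ext z
    simp only [gap, mem_inter_iff, mem_ofPred_eq, h, IsEmpty.forall_iff, and_true]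
    refine and_congr ?_ ?_ <;> constructor <;> intro h <;> linarith

/-- A point beyond an outer line lies in a half-plane that misses `body`; a point of a gap escapes
upwards into y > 2. -/
theorem exists_unbounded_of_notMem_body {z : Plane} (hz : z ∉ body k) :
    ∃ S : Set Plane, z ∈ S ∧ IsPreconnected S ∧ S ⊆ (body k)ᶜ ∧ ¬ Bornology.IsBounded S := by
  have top : ¬ Bornology.IsBounded {z : Plane | 0 * z 0 + (-1) * z 1 < -2} :=
    Plane.not_isBounded fun R => ⟨!₂[0, |R| + 3], by simp; linarith [abs_nonneg R], 1, by
      simp only [Matrix.cons_val_one, Matrix.cons_val_fin_one]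
      rw [abs_of_nonneg (by positivity)]; linarith [le_abs_self R]⟩
  have htop : {z : Plane | 0 * z 0 + (-1) * z 1 < -2} ⊆ (body k)ᶜ := by
    intro w hw hb
    have hw : 0 * w 0 + (-1) * w 1 < -2 := hw
    linarith [hb.1.2.1]
  by_cases h0 : z 0 < 0
  · refine ⟨{z | 1 * z 0 + 0 * z 1 < 0}, ?_, (Plane.convex_halfPlane_lt _ _ _).isPreconnected,
      ?_, ?_⟩
    · simpa using h0
    · intro w hw hb
      have hw : 1 * w 0 + 0 * w 1 < 0 := hw
      linarith [hb.1.1]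
    · refine Plane.not_isBounded fun R => ⟨!₂[-(|R| + 1), 0], ?_, 0, ?_⟩
      · simp; linarith [abs_nonneg R]
      · simp only [Matrix.cons_val_zero, abs_neg]
        rw [abs_of_nonneg (by positivity)]; linarith [le_abs_self R]
  by_cases h1 : 2 < z 1
  · refine ⟨_, ?_, (Plane.convex_halfPlane_lt _ _ _).isPreconnected, htop, top⟩
    simpa using h1
  by_cases h2 : z 0 + 6 * z 1 < 0
  · refine ⟨{z | 1 * z 0 + 6 * z 1 < 0}, ?_, (Plane.convex_halfPlane_lt _ _ _).isPreconnected,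
      ?_, ?_⟩
    · simpa using h2
    · intro w hw hb
      have hw : 1 * w 0 + 6 * w 1 < 0 := hw
      linarith [hb.1.2.2]
    · refine Plane.not_isBounded fun R => ⟨!₂[-(|R| + 1), 0], ?_, 0, ?_⟩
      · simp; linarith [abs_nonneg R]
      · simp only [Matrix.cons_val_zero, abs_neg]
        rw [abs_of_nonneg (by positivity)]; linarith [le_abs_self R]
  obtain ⟨j, hj, hzj⟩ : ∃ j < k, z ∈ gap k j := by
    by_contra! hcon
    exact hz ⟨⟨not_lt.1 h0, not_lt.1 h1, not_lt.1 h2⟩, hcon⟩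
  refine ⟨gap k j ∪ {z | 0 * z 0 + (-1) * z 1 < -2}, .inl hzj, ?_, ?_,
    fun hb => top (hb.subset subset_union_right)⟩
  · refine IsPreconnected.union (!₂[4 * (j : ℝ) + 7 / 2, 21 / 10] : Plane) ?_ ?_ (convex_gap k j).isPreconnected
      (Plane.convex_halfPlane_lt 0 (-1) (-2)).isPreconnected
    · refine ⟨?_, ?_, fun _ => ?_⟩ <;> simp <;> linarith
    · simp; norm_num
  · exact union_subset (fun w hw hb => hb.2 j hj hw) htop

/-- The complement of a gap is locally a half-plane or everything, except at the corners of the gap.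
These are C, the next A, and (4j+4, 5/2), where line BC meets the next wall; the first two are
vertices and the third lies above y = 2. -/
theorem convexNear_body (hn : 3 * k ≤ n) {z : Plane} (hz : z ∈ body k)
    (hv : ∀ i < n, z ≠ vtx k i) : ConvexNear (body k) z := by
  refine ConvexNear.inter ?_ (ConvexNear.iInter_lt fun j hj => ?_)
  · refine ConvexNear.of_eventuallyEq (T := {z : Plane | (-1) * z 0 + 0 * z 1 ≤ 0} ∩
      ({z | 0 * z 0 + 1 * z 1 ≤ 2} ∩ {z | (-1) * z 0 + (-6) * z 1 ≤ 0}))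
      ((Plane.convex_halfPlane_le _ _ _).inter ((Plane.convex_halfPlane_le _ _ _).inter
        (Plane.convex_halfPlane_le _ _ _))) (Eventually.of_forall fun w => ?_)
    simp only [mem_inter_iff, mem_ofPred_eq]
    refine and_congr ?_ (and_congr ?_ ?_) <;> constructor <;> intro h <;> linarith
  obtain ⟨⟨h0, h1, h2⟩, h3⟩ := hz
  by_cases hs : z 0 - 4 * j + 1 < 2 * z 1 ∨ z 0 + 3 * z 1 < 4 * j + 4 ∨
      (j + 1 < k ∧ 4 * j + 4 < z 0)
  · refine ConvexNear.of_eventuallyEq convex_univ ?_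
    filter_upwards [compl_gap_mem_nhds hs] with w hw
    exact iff_of_true hw trivial
  push Not at hs
  obtain ⟨c1, c2, c3⟩ := hs
  have hC : ¬ (z 0 = 4 * j + 1 ∧ z 1 = 1) := fun h => hv (3 * j + 2) (by omega) (by
    rw [vtx_three_mul_add_two hj]; exact Plane.ext (by simp [h.1]) (by simp [h.2]))
  have hA : j + 1 < k → ¬ (z 0 = 4 * j + 4 ∧ z 1 = 0) := fun hjk h =>
    hv (3 * (j + 1)) (by omega) (by
      rw [vtx_three_mul hjk]
      exact Plane.ext (by simp [h.1]; ring) (by simp [h.2]))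
  have k1 : ContinuousAt (fun z : Plane => z 0 - 4 * j + 1 - 2 * z 1) z := by fun_prop
  have k2 : ContinuousAt (fun z : Plane => z 0 + 3 * z 1) z := by fun_prop
  have k3 : ContinuousAt (fun z : Plane => z 0) z := by fun_prop
  have e1 : 2 * z 1 < z 0 - 4 * j + 1 → ∀ᶠ w : Plane in 𝓝 z, 2 * w 1 < w 0 - 4 * j + 1 :=
    fun h => (k1.eventually (lt_mem_nhds (sub_pos.2 h))).mono fun w hw => sub_pos.1 hw
  have e2 : 4 * j + 4 < z 0 + 3 * z 1 → ∀ᶠ w : Plane in 𝓝 z, 4 * j + 4 < w 0 + 3 * w 1 :=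
    fun h => k2.eventually (lt_mem_nhds h)
  have e3 : (j + 1 < k → z 0 < 4 * j + 4) →
      ∀ᶠ w : Plane in 𝓝 z, j + 1 < k → w 0 < 4 * j + 4 := by
    intro h
    by_cases hjk : j + 1 < k
    · exact (k3.eventually (gt_mem_nhds (h hjk))).mono fun w hw _ => hw
    · exact Eventually.of_forall fun w hw => (hjk hw).elim
  rcases not_mem_gap_iff.1 (h3 j hj) with h | h | ⟨hjk, h⟩
  · refine ConvexNear.of_eventuallyEq (Plane.convex_halfPlane_le 1 (-2) (4 * j - 1)) ?_
    have h4 : 4 * j + 4 < z 0 + 3 * z 1 :=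
      lt_of_le_of_ne c2 fun he => hC ⟨by linarith, by linarith⟩
    filter_upwards [e2 h4, e3 fun _ => by linarith] with w w2 w3
    rw [not_mem_gap_iff]
    constructor
    · rintro (hw | hw | ⟨hw, hw'⟩)
      · linarith
      · linarith
      · linarith [w3 hw]
    · intro hw
      have hw : 1 * w 0 + (-2) * w 1 ≤ 4 * j - 1 := hw
      left; linarith
  · refine ConvexNear.of_eventuallyEq (Plane.convex_halfPlane_le 1 3 (4 * j + 4)) ?_
    have h4 : 2 * z 1 < z 0 - 4 * j + 1 :=
      lt_of_le_of_ne c1 fun he => hC ⟨by linarith, by linarith⟩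
    have h5 : j + 1 < k → z 0 < 4 * j + 4 := fun hjk =>
      lt_of_le_of_ne (c3 hjk) fun he => hA hjk ⟨by linarith, by linarith⟩
    filter_upwards [e1 h4, e3 h5] with w w1 w3
    rw [not_mem_gap_iff]
    constructor
    · rintro (hw | hw | ⟨hw, hw'⟩)
      · linarith
      · linarith
      · linarith [w3 hw]
    · intro hw
      have hw : 1 * w 0 + 3 * w 1 ≤ 4 * j + 4 := hw
      right; left; linarith
  · refine ConvexNear.of_eventuallyEq (Plane.convex_halfPlane_le (-1) 0 (-(4 * j + 4))) ?_
    have h4 : 2 * z 1 < z 0 - 4 * j + 1 := by linarith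
    have h5 : 4 * j + 4 < z 0 + 3 * z 1 :=
      lt_of_le_of_ne c2 fun he => hA hjk ⟨by linarith [c3 hjk], by linarith [c3 hjk]⟩
    filter_upwards [e1 h4, e2 h5] with w w1 w2
    rw [not_mem_gap_iff]
    constructor
    · rintro (hw | hw | ⟨hw, hw'⟩)
      · linarith
      · linarith
      · linarith
    · intro hw
      have hw : (-1) * w 0 + 0 * w 1 ≤ -(4 * j + 4) := hw
      right; right; exact ⟨hjk, by linarith⟩

section polygon

variable [NeZero n] (hk : 0 < k) (hn : 3 * k ≤ n) (hn2 : n ≤ 3 * k + 2)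

theorem region_polygon : (polygon k n hk hn hn2).region = body k := by
  refine CurvilinearPolygon.region_eq _ ?_ (isBounded_body hk) (isClosed_body k) ?_
    fun z hz => exists_unbounded_of_notMem_body hz
  · intro z hz
    obtain ⟨i, hi, hzi⟩ := (mem_boundary_polygon hk hn hn2).1 hz
    exact side_subset_body hk hn hn2 hi hzi
  · intro z hz hzb
    exact body_mem_nhds hk hn hn2 hz fun i hi hzi =>
      hzb ((mem_boundary_polygon hk hn hn2).2 ⟨i, hi, hzi⟩)

theorem isPiecewiseConvex_polygon : (polygon k n hk hn hn2).IsPiecewiseConvex := by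
  refine ⟨fun p hp hpv => ?_, isConvexArc_edge hk hn hn2⟩
  rw [region_polygon]
  obtain ⟨i, hi, hpi⟩ := (mem_boundary_polygon hk hn hn2).1 hp
  refine (convexNear_body hn (side_subset_body hk hn hn2 hi hpi) fun i hi he => ?_).exists_pos
  exact hpv ⟨⟨i, hi⟩, he.symm⟩

end polygon

/-! ### Visibility of the tips and the lower bound -/

/-- A point near the tip of the `j`-th tooth. -/
noncomputable def tip (j : ℕ) : Plane := !₂[4 * (j : ℝ) + 14 / 5, 39 / 20]

theorem tip_mem_interior_body {j : ℕ} (hj : j < k) : tip j ∈ interior (body k) := by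
  rw [mem_interior_iff_mem_nhds]
  have hj0 : (0 : ℝ) ≤ j := j.cast_nonneg
  have c0 : ContinuousAt (fun z : Plane => z 0) (tip j) := by fun_prop
  have c1 : ContinuousAt (fun z : Plane => z 1) (tip j) := by fun_prop
  have c2 : ContinuousAt (fun z : Plane => z 0 + 6 * z 1) (tip j) := by fun_prop
  refine inter_mem (inter_mem ?_ (inter_mem ?_ ?_)) ?_
  · exact (c0.eventually (lt_mem_nhds (a := 0) (by simp [tip]; linarith))).mono
      fun w hw => le_of_lt hw
  · exact (c1.eventually (gt_mem_nhds (show (tip j) 1 < 2 by simp [tip]; norm_num))).mono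
      fun w hw => le_of_lt hw
  · exact (c2.eventually (lt_mem_nhds (a := 0) (by simp [tip]; linarith))).mono
      fun w hw => le_of_lt hw
  · refine (Set.finite_lt_nat k).eventually_all.2 fun i hi => compl_gap_mem_nhds ?_
    simp only [tip, Matrix.cons_val_zero, Matrix.cons_val_one, Matrix.cons_val_fin_one]
    rcases lt_or_ge i j with h | h
    · have h' : (i : ℝ) + 1 ≤ j := by exact_mod_cast h
      exact .inr (.inr ⟨by omega, by linarith⟩)
    · have h' : (j : ℝ) ≤ i := by exact_mod_cast h
      exact .inl (by linarith)

/-- The points that see the tip of a tooth past the gap on its right. -/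
theorem le_of_segment_subset_compl_gap {j : ℕ} {q : Plane}
    (hseg : segment ℝ (tip j) q ⊆ (gap k j)ᶜ) (hq : q 1 ≤ 2) :
    19 * (q 0 - 4 * j - 1) ≤ 36 * (q 1 - 1) ∨ q 0 - 4 * j + 1 ≤ 2 * q 1 := by
  -- The line from C to the point `tip j` has slope 19/36. A point below it and below line BC has
  -- its view blocked by the gap.
  by_contra! hcon
  obtain ⟨h1, h2⟩ := hcon
  set u := q 0 - 4 * j with hu
  have hd : 0 < 1 / 10 + (u + 1 - 2 * q 1) := by linarith
  -- The parameter where the segment crosses line BC; 1/10 is the value of 2y − (x − 4j + 1) at `tip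
  -- j`.
  obtain ⟨t₁, ht₁⟩ : ∃ t₁, t₁ = 1 / 10 / (1 / 10 + (u + 1 - 2 * q 1)) := ⟨_, rfl⟩
  have ht0 : 0 < t₁ := by rw [ht₁]; positivity
  have ht1 : t₁ < 1 := by rw [ht₁, div_lt_one hd]; linarith
  have hzero : t₁ * (1 / 10 + (u + 1 - 2 * q 1)) = 1 / 10 := by
    rw [ht₁, div_mul_cancel₀ _ hd.ne']
  -- The crossing is to the right of C because `q` is below the sight line, and left of the next
  -- wall because y ≤ 2. Just past it the segment is inside the gap.
  have hgap : 4 < (14 / 5 + t₁ * (u - 14 / 5)) + 3 * (39 / 20 + t₁ * (q 1 - 39 / 20)) := by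
    nlinarith
  have hwall : 14 / 5 + t₁ * (u - 14 / 5) < 4 := by nlinarith
  have k1 : ContinuousAt (fun t : ℝ =>
      (14 / 5 + t * (u - 14 / 5)) + 3 * (39 / 20 + t * (q 1 - 39 / 20))) t₁ := by fun_prop
  have k2 : ContinuousAt (fun t : ℝ => 14 / 5 + t * (u - 14 / 5)) t₁ := by fun_prop
  have ev : ∀ᶠ t in 𝓝[>] t₁, t₁ < t ∧ t < 1 ∧
      4 < (14 / 5 + t * (u - 14 / 5)) + 3 * (39 / 20 + t * (q 1 - 39 / 20)) ∧
      14 / 5 + t * (u - 14 / 5) < 4 := by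
    filter_upwards [self_mem_nhdsWithin, nhdsWithin_le_nhds (gt_mem_nhds ht1),
      nhdsWithin_le_nhds (k1.eventually (lt_mem_nhds hgap)),
      nhdsWithin_le_nhds (k2.eventually (gt_mem_nhds hwall))] with t a b c d
    exact ⟨a, b, c, d⟩
  obtain ⟨t, t1, t2, t3, t4⟩ := ev.exists
  have hmem : !₂[4 * j + (14 / 5 + t * (u - 14 / 5)), 39 / 20 + t * (q 1 - 39 / 20)] ∈
      segment ℝ (tip j) q := by
    rw [Plane.mem_segment_iff]
    refine ⟨t, by linarith, t2.le, ?_, ?_⟩ <;> simp [tip, hu]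
    ring
  refine hseg hmem ⟨?_, ?_, fun _ => ?_⟩ <;>
    simp only [Matrix.cons_val_zero, Matrix.cons_val_one, Matrix.cons_val_fin_one]
  · nlinarith
  · linarith
  · linarith

/-- The points that see the tip of a tooth lie in the upper part of that tooth. -/
theorem bounds_of_segment_subset_body {j : ℕ} (hj : j < k) {q : Plane}
    (hseg : segment ℝ (tip j) q ⊆ body k) :
    4 * j ≤ q 0 ∧ q 0 ≤ 4 * j + 3 ∧ 2 / 5 ≤ q 1 := by
  have key : ∀ q : Plane, segment ℝ (tip j) q ⊆ body k →
      19 * (q 0 - 4 * j - 1) ≤ 36 * (q 1 - 1) ∨ q 0 - 4 * j + 1 ≤ 2 * q 1 := fun q h =>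
    le_of_segment_subset_compl_gap (fun w hw => (h hw).2 j hj)
      (h (right_mem_segment ℝ _ _)).1.2.1
  have hqb := hseg (right_mem_segment ℝ _ _)
  have hq2 := hqb.1.2.1
  have hleft : 4 * j ≤ q 0 := by
    by_contra! hlt
    rcases Nat.eq_zero_or_pos j with rfl | hjpos
    · have := hqb.1.1
      simp at hlt
      linarith
    -- A point of the segment at most 1/10 to the left of the wall. The sight line through C is
    -- still above height 2/5 there, so this point falls into the previous gap.
    obtain ⟨x, hx⟩ : ∃ x, x = max (q 0) (4 * j - 1 / 10) := ⟨_, rfl⟩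
    have hx1 : q 0 ≤ x := hx ▸ le_max_left _ _
    have hx2 : 4 * j - 1 / 10 ≤ x := hx ▸ le_max_right _ _
    have hx3 : x < 4 * j := hx ▸ max_lt hlt (by linarith)
    obtain ⟨t, ht⟩ : ∃ t, t = (4 * j + 14 / 5 - x) / (4 * j + 14 / 5 - q 0) := ⟨_, rfl⟩
    have hd : 0 < 4 * j + 14 / 5 - q 0 := by linarith
    have htx : t * (4 * j + 14 / 5 - q 0) = 4 * j + 14 / 5 - x := by
      rw [ht, div_mul_cancel₀ _ hd.ne']
    have hr : !₂[x, 39 / 20 + t * (q 1 - 39 / 20)] ∈ segment ℝ (tip j) q := by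
      rw [Plane.mem_segment_iff]
      refine ⟨t, ?_, ?_, ?_, ?_⟩
      · rw [ht]; exact div_nonneg (by linarith) hd.le
      · rw [ht, div_le_one hd]; linarith
      · simp [tip]; linarith
      · simp [tip]
    obtain ⟨r, hr0, hr⟩ : ∃ r : Plane, r 0 = x ∧ r ∈ segment ℝ (tip j) q := ⟨_, by simp, hr⟩
    have hrs : segment ℝ (tip j) r ⊆ body k :=
      ((convex_segment _ _).segment_subset (left_mem_segment ℝ _ _) hr).trans hseg
    have hrb := hseg hr
    have hr1 : 2 / 5 ≤ r 1 := by
      rcases key r hrs with h | h <;> linarith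
    have hj' : (((j - 1 : ℕ) : ℝ)) = j - 1 := by push_cast [Nat.cast_sub hjpos]; ring
    have hr2 := hrb.1.2.1
    refine hrb.2 (j - 1) (by omega) ⟨?_, ?_, fun _ => ?_⟩ <;> rw [hj'] <;> linarith
  rcases key q hseg with h | h
  · exact ⟨hleft, by linarith, by linarith⟩
  · exact ⟨hleft, by linarith, by linarith⟩

/-- The base lies below height 2/5, and a descending edge sinks below it at x = 4j + 14/5, before
the next tooth. -/
theorem tooth_of_mem_side {i : ℕ} {z : Plane} (hk : 0 < k) (hn : 3 * k ≤ n)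
    (hn2 : n ≤ 3 * k + 2) (hi : i < n) (hz : z ∈ side k n i) (hz1 : 2 / 5 ≤ z 1) :
    ∃ j : ℕ, j = i / 3 ∧ 4 * j ≤ z 0 ∧ (j + 1 < k → z 0 < 4 * j + 4) := by
  rcases side_cases hk hn hn2 hi hz with ⟨j, a1, a2, a3 | a3, -⟩ |
    ⟨j, a1, a2, a3, -⟩ | ⟨j, a1, a2, a3, -⟩ |
    ⟨j, a1, a2, a3, -⟩ | ⟨j, a1, a2, a3 | a3, -⟩ |
    ⟨j, a1, a2, a3, -⟩ | ⟨j, a1, a2, a3, -⟩ <;>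
  obtain ⟨a4, a5, a6⟩ := a3 <;>
  first
  | exact ⟨j, by omega, by linarith, fun _ => by linarith⟩
  | (exfalso; linarith)

/-- The vertical line x = 4i + 7/2 lies in the gap for 1/6 < y < 9/4, and the segment crosses it at
a height between 2/5 and 2. -/
theorem not_segment_subset_body {i j : ℕ} (hij : i < j) (hj : j < k) {p q : Plane}
    (hp0 : p 0 ≤ 4 * i + 3) (hp1 : 2 / 5 ≤ p 1) (hq0 : 4 * j ≤ q 0) (hq1 : 2 / 5 ≤ q 1) :
    ¬ segment ℝ p q ⊆ body k := by
  intro h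
  have hc : (i : ℝ) + 1 ≤ j := by exact_mod_cast hij
  have hd : 0 < q 0 - p 0 := by linarith
  obtain ⟨t, ht⟩ : ∃ t, t = (4 * i + 7 / 2 - p 0) / (q 0 - p 0) := ⟨_, rfl⟩
  have htx : t * (q 0 - p 0) = 4 * i + 7 / 2 - p 0 := by rw [ht, div_mul_cancel₀ _ hd.ne']
  have ht0 : 0 ≤ t := by rw [ht]; exact div_nonneg (by linarith) hd.le
  have ht1 : t ≤ 1 := by rw [ht, div_le_one hd]; linarith
  have hr : !₂[4 * (i : ℝ) + 7 / 2, p 1 + t * (q 1 - p 1)] ∈ segment ℝ p q := by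
    rw [Plane.mem_segment_iff]
    exact ⟨t, ht0, ht1, by simp; linarith, by simp⟩
  have hb := h hr
  have h2 := hb.1.2.1
  refine hb.2 i (by omega) ⟨?_, ?_, fun _ => ?_⟩ <;>
    simp only [Matrix.cons_val_zero, Matrix.cons_val_one, Matrix.cons_val_fin_one] at h2 ⊢
  · linarith
  · nlinarith
  · linarith

section polygon

variable [NeZero n] (hk : 0 < k) (hn : 3 * k ≤ n) (hn2 : n ≤ 3 * k + 2)

/-- A mobile guard sees the tip of at most one tooth. -/
theorem eq_of_visible_of_visible {g : Set Plane}
    (hg : (polygon k n hk hn hn2).IsMobileGuard g) {i j : ℕ} (hi : i < k) (hj : j < k)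
    {p q : Plane} (hp : p ∈ g) (hq : q ∈ g)
    (hpi : (polygon k n hk hn hn2).Visible (tip i) p)
    (hqj : (polygon k n hk hn hn2).Visible (tip j) q) : i = j := by
  rw [CurvilinearPolygon.Visible, region_polygon] at hpi hqj
  obtain ⟨p1, p2, p3⟩ := bounds_of_segment_subset_body hi hpi
  obtain ⟨q1, q2, q3⟩ := bounds_of_segment_subset_body hj hqj
  rcases hg with ⟨a, rfl⟩ | ⟨a, b, -, rfl, hab⟩
  · rw [edge_polygon] at hp hq
    have key : ∀ {j : ℕ} {q : Plane}, j < k → q ∈ side k n a → 4 * j ≤ q 0 → q 0 ≤ 4 * j + 3 →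
        2 / 5 ≤ q 1 → j = a / 3 := by
      intro j q hj hq q1 q2 q3
      obtain ⟨b, hb, h1, h2⟩ := tooth_of_mem_side hk hn hn2 a.2 hq q3
      rw [← hb]
      rcases lt_trichotomy j b with h | h | h
      · have h : (j : ℝ) + 1 ≤ b := by exact_mod_cast h
        linarith
      · exact h
      · have h' : (b : ℝ) + 1 ≤ j := by exact_mod_cast h
        linarith [h2 (by omega)]
    rw [key hi hp p1 p2 p3, key hj hq q1 q2 q3]
  · rw [region_polygon] at hab
    have hsub : segment ℝ p q ⊆ body k :=
      ((convex_segment _ _).segment_subset hp hq).trans hab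
    rcases lt_trichotomy i j with h | h | h
    · exact (not_segment_subset_body h hj p2 p3 q1 q3 hsub).elim
    · exact h
    · rw [segment_symm] at hsub
      exact (not_segment_subset_body h hi q2 q3 p1 p3 hsub).elim

theorem le_encard_of_isMobileGuardSet {G : Set (Set Plane)}
    (hG : (polygon k n hk hn hn2).IsMobileGuardSet G) : (k : ℕ∞) ≤ G.encard := by
  have h : ∀ j : Fin k, ∃ g ∈ G, ∃ q ∈ g, (polygon k n hk hn hn2).Visible (tip j) q := fun j =>
    hG.2 _ (by rw [region_polygon]; exact tip_mem_interior_body j.2)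
  choose f hf q hq hv using h
  have hinj : Function.Injective f := fun i j hij => Fin.ext <|
    eq_of_visible_of_visible hk hn hn2 (hG.1 _ (hf i)) i.2 j.2 (hq i) (hij ▸ hq j) (hv i) (hv j)
  calc (k : ℕ∞) = ENat.card (Fin k) := by simp
    _ ≤ (range f).encard := hinj.encard_range
    _ ≤ G.encard := encard_le_encard (range_subset_iff.2 hf)

end polygon

end Comb

theorem mainTheorem9 (n : ℕ) [NeZero n] (hn : 3 ≤ n) :
    ∃ P : CurvilinearPolygon n, P.IsPiecewiseConvex ∧
      ∀ G : Set (Set Plane), P.IsMobileGuardSet G → ((n / 3 : ℕ) : ℕ∞) ≤ G.encard :=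
  ⟨Comb.polygon (n / 3) n (by omega) (by omega) (by omega),
    Comb.isPiecewiseConvex_polygon _ _ _,
    fun _ hG => Comb.le_encard_of_isMobileGuardSet _ _ _ hG⟩
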